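/- Let $R\subset S$ be a proper extension of commutative unital rings, where $R$ is local with maximal ideal $M$ ($R$ is not assumed Noetherian). Let $[R,S]$ be the set of $R$-subalgebras of $S$, ordered by inclusion; it is a lattice with infimum $T\cap U$ and supremum the compositum $TU$. Assume that * $R\subset S$ has FIP, that is, $[R,S]$ is finite; * $R\subset S$ is infra-integral, that is, $S$ is integral over $R$ and, for each prime ideal $Q$ of $S$ with $P:=Q\cap R$, the residual extension $R_P/PR_P\to S_Q/QS_Q$ is an isomorphism. Call $R\subset S$ Boolean if $[R,S]$ is a Boolean lattice, that is, $[R,S]$ is distributive and each $T\in[R,S]$ has a complement $T'\in[R,S]$ (meaning $T\cap T'=R$ and $TT'=S$). Then $R\subset S$ is Boolean if and only if there exist $x,y\in S$ such that $$S=R[x,y],\qquad x^2,\ xy,\ y^2-y\in M,\qquad xM\subseteq M,\quad yM\subseteq M .$$ Moreover, for all $x,y\in S$ satisfying these conditions, $S=R[x,y]=R[x+y]$. -/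

import Mathlib

/-- `R ⊆ S` is an FIP extension: the set `[R, S]` of `R`-subalgebras of `S` is finite. -/
def IsFIPExtension (R S : Type*) [CommRing R] [CommRing S] [Algebra R S] : Prop :=
  Finite (Subalgebra R S)

/-- `R ⊆ S` is a distributive extension: in the lattice `[R, S]`, intersection (`⊓`) and
product, i.e. compositum (`⊔`), each distribute over the other. -/
structure IsDistributiveExtension (R S : Type*) [CommRing R] [CommRing S] [Algebra R S] :
    Prop where
  inf_sup : ∀ T U V : Subalgebra R S, T ⊓ (U ⊔ V) = (T ⊓ U) ⊔ (T ⊓ V)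
  sup_inf : ∀ T U V : Subalgebra R S, T ⊔ (U ⊓ V) = (T ⊔ U) ⊓ (T ⊔ V)

/-- `R ⊆ S` is a Boolean extension: it is distributive, and every `T ∈ [R, S]` has a complement
`T'`, i.e. `T ∩ T' = R` and `T T' = S` (such a `T'` is automatically unique). -/
structure IsBooleanExtension (R S : Type*) [CommRing R] [CommRing S] [Algebra R S] :
    Prop where
  distributive : IsDistributiveExtension R S
  exists_compl : ∀ T : Subalgebra R S, ∃ T' : Subalgebra R S, T ⊓ T' = ⊥ ∧ T ⊔ T' = ⊤

/-- `R ⊆ S` is infra-integral: it is integral, and for every prime `Q` of `S`, with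
`P := Q ∩ R`, the residual extension `κ_R(P) → κ_S(Q)` is an isomorphism. -/
structure IsInfraIntegralExtension (R S : Type*) [CommRing R] [CommRing S] [Algebra R S] :
    Prop where
  isIntegral : Algebra.IsIntegral R S
  bijective_residue : ∀ (Q : Ideal S) [Q.IsPrime],
    Function.Bijective
      (Ideal.ResidueField.map (Q.comap (algebraMap R S)) Q (algebraMap R S) rfl)

/-- The maximal ideal `M` of the local ring `R`, viewed as a subset of `S` (it is the image of
`M`, not the ideal `MS` of `S` generated by it). -/
def maximalIdealIn (R S : Type*) [CommRing R] [IsLocalRing R] [CommRing S] [Algebra R S] :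
    Set S :=
  algebraMap R S '' (IsLocalRing.maximalIdeal R : Set R)

/-- The condition on `x, y ∈ S`: `S = R[x, y]`, `x ^ 2, x y, y ^ 2 - y ∈ M`, and
`x M ⊆ M`, `y M ⊆ M`. -/
structure IsSpecialPair (R : Type*) {S : Type*} [CommRing R] [IsLocalRing R] [CommRing S]
    [Algebra R S] (x y : S) : Prop where
  adjoin_eq_top : Algebra.adjoin R {x, y} = ⊤
  sq_mem : x ^ 2 ∈ maximalIdealIn R S
  mul_mem : x * y ∈ maximalIdealIn R S
  sq_sub_mem : y ^ 2 - y ∈ maximalIdealIn R S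
  left_mul_mem : ∀ m ∈ maximalIdealIn R S, x * m ∈ maximalIdealIn R S
  right_mul_mem : ∀ m ∈ maximalIdealIn R S, y * m ∈ maximalIdealIn R S

/-! Everything reduces to an algebra `A = S/M` over the field `K = R/M`. This works once `M` is an
ideal of `S`: the special pair supplies this directly, and in the Boolean case it follows from
Nakayama applied to atoms of `[R, S]` (`mul_mem_maximalIdealIn_of_isBooleanExtension`). Subalgebras
of `S` then correspond to those of `A`.

Over `K`, a square-zero or idempotent `z` has `K[z] = K + Kz`, so distributivity makes `z` prime for
joins. Hence all square-zero elements lie in one `K[x]` and all idempotents in one `K[y]`.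
Infra-integrality puts such an element, outside `K`, in every subalgebra other than `K`, so the
complement of `K[x, y]` is `K`. Conversely, if `x ^ 2 = 0`, `x * y = 0`, `y ^ 2 = y`, a subalgebra
of `K[x, y]` is determined by which of `x`, `y` it contains. -/

theorem Algebra.mem_adjoin_singleton_iff_of_sq {K A : Type*} [CommRing K] [CommRing A] [Algebra K A]
    {z : A} {c : K} (hz : z ^ 2 = algebraMap K A c * z) {w : A} :
    w ∈ Algebra.adjoin K {z} ↔ ∃ a b : K, w = algebraMap K A a + algebraMap K A b * z := by
  constructor
  · intro hw
    induction hw using Algebra.adjoin_induction with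
    | mem u hu => exact ⟨0, 1, by simpa using hu⟩
    | algebraMap r => exact ⟨r, 0, by simp⟩
    | add u v _ _ hu hv =>
      obtain ⟨a, b, rfl⟩ := hu
      obtain ⟨a', b', rfl⟩ := hv
      exact ⟨a + a', b + b', by simp only [map_add]; ring⟩
    | mul u v _ _ hu hv =>
      obtain ⟨a, b, rfl⟩ := hu
      obtain ⟨a', b', rfl⟩ := hv
      refine ⟨a * a', a * b' + b * a' + b * b' * c, ?_⟩
      simp only [map_add, map_mul]
      linear_combination (algebraMap K A b * algebraMap K A b') * hz
  · rintro ⟨a, b, rfl⟩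
    exact add_mem (Subalgebra.algebraMap_mem _ _)
      (mul_mem (Subalgebra.algebraMap_mem _ _) (Algebra.self_mem_adjoin_singleton K z))

/-! ### Algebras over a field: square-zero elements and idempotents -/

section Field

variable {K A : Type*} [Field K] [CommRing A] [Algebra K A]

theorem Subalgebra.mem_of_algebraMap_mul_mem {T : Subalgebra K A} {b : K} (hb : b ≠ 0) {z : A}
    (h : algebraMap K A b * z ∈ T) : z ∈ T := by
  have := mul_mem (Subalgebra.algebraMap_mem T b⁻¹) h
  rwa [← mul_assoc, ← map_mul, inv_mul_cancel₀ hb, map_one, one_mul] at this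

/-- Both square-zero elements and idempotents generate subalgebras of dimension at most two. -/
def IsSqZeroOrIdem (z : A) : Prop := z ^ 2 = 0 ∨ z ^ 2 = z

theorem IsSqZeroOrIdem.mem_adjoin_iff {z w : A} (hz : IsSqZeroOrIdem z) :
    w ∈ Algebra.adjoin K {z} ↔ ∃ a b : K, w = algebraMap K A a + algebraMap K A b * z := by
  rcases hz with hz | hz
  · exact Algebra.mem_adjoin_singleton_iff_of_sq (c := 0) (by simpa using hz)
  · exact Algebra.mem_adjoin_singleton_iff_of_sq (c := 1) (by simpa using hz)

theorem IsSqZeroOrIdem.mem_adjoin_of_mem {z w : A} (hz : IsSqZeroOrIdem z)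
    (hw : w ∈ Algebra.adjoin K {z}) (hw' : w ∉ (⊥ : Subalgebra K A)) :
    z ∈ Algebra.adjoin K {w} := by
  obtain ⟨a, b, rfl⟩ := hz.mem_adjoin_iff.1 hw
  have hb : b ≠ 0 := by
    rintro rfl
    exact hw' (by simp)
  refine Subalgebra.mem_of_algebraMap_mul_mem hb ?_
  have := sub_mem (Algebra.self_mem_adjoin_singleton K (algebraMap K A a + algebraMap K A b * z))
    (Subalgebra.algebraMap_mem _ a)
  simpa using this

/-- Since `K[z]` has dimension at most two, it meets in `K` every subalgebra missing `z`. If both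
`T` and `U` missed `z`, distributivity would force `K[z] ⊓ (T ⊔ U) = K`, although `z` lies in it. -/
theorem IsSqZeroOrIdem.mem_or_mem_of_mem_sup (hd : IsDistributiveExtension K A) {z : A}
    (hz : IsSqZeroOrIdem z) {T U : Subalgebra K A} (h : z ∈ T ⊔ U) : z ∈ T ∨ z ∈ U := by
  by_contra! hc
  have key : ∀ V : Subalgebra K A, z ∉ V → Algebra.adjoin K {z} ⊓ V = ⊥ := by
    intro V hV
    rw [eq_bot_iff]
    intro w hw
    by_contra hw'
    exact hV (Algebra.adjoin_le (Set.singleton_subset_iff.2 hw.2)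
      (hz.mem_adjoin_of_mem hw.1 hw'))
  have h1 := hd.inf_sup (Algebra.adjoin K {z}) T U
  rw [key T hc.1, key U hc.2, sup_idem] at h1
  have h2 : z ∈ (⊥ : Subalgebra K A) := h1 ▸ ⟨Algebra.self_mem_adjoin_singleton K z, h⟩
  exact hc.1 (bot_le (a := T) h2)

theorem eq_zero_of_sq_eq_zero_of_mem_bot {z : A} (hz : z ^ 2 = 0)
    (h : z ∈ (⊥ : Subalgebra K A)) : z = 0 := by
  obtain ⟨a, rfl⟩ := Algebra.mem_bot.1 h
  cases subsingleton_or_nontrivial A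
  · exact Subsingleton.elim _ _
  · rw [← map_pow, map_eq_zero] at hz
    simp [pow_eq_zero_iff two_ne_zero |>.1 hz]

theorem eq_zero_or_eq_zero_of_algebraMap_mul {a : K} {z : A} (h : algebraMap K A a * z = 0) :
    a = 0 ∨ z = 0 := by
  rw [← Algebra.smul_def] at h
  exact smul_eq_zero.1 h

theorem mul_eq_algebraMap_mul_of_mem_adjoin {x w : A} (hx : x ^ 2 = 0)
    (h : x * w ∈ Algebra.adjoin K {x}) : ∃ b : K, x * w = algebraMap K A b * x := by
  obtain ⟨a, b, hab⟩ := (IsSqZeroOrIdem.mem_adjoin_iff (Or.inl hx)).1 h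
  have : algebraMap K A a * x = 0 := by linear_combination (-x) * hab + (w - algebraMap K A b) * hx
  rcases eq_zero_or_eq_zero_of_algebraMap_mul this with rfl | rfl
  · exact ⟨b, by simpa using hab⟩
  · exact ⟨0, by simp⟩

/-- If `x * x' = 0`, then `x + x'` is square-zero, so it lies in `K[x]` or `K[x']`. Otherwise `x *
x'` is square-zero and is a scalar multiple of `x` or of `x'`; multiplying by the other factor gives
a contradiction. -/
theorem mem_adjoin_of_sq_eq_zero (hd : IsDistributiveExtension K A) {x x' : A} (hx : x ^ 2 = 0)
    (hx0 : x ≠ 0) (hx' : x' ^ 2 = 0) : x' ∈ Algebra.adjoin K {x} := by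
  have hxT : x ∈ Algebra.adjoin K {x} ⊔ Algebra.adjoin K {x'} :=
    le_sup_left (a := Algebra.adjoin K {x}) (Algebra.self_mem_adjoin_singleton K x)
  have hxU : x' ∈ Algebra.adjoin K {x} ⊔ Algebra.adjoin K {x'} :=
    le_sup_right (b := Algebra.adjoin K {x'}) (Algebra.self_mem_adjoin_singleton K x')
  by_cases h : x * x' = 0
  · have hg : IsSqZeroOrIdem (x + x') := Or.inl (by linear_combination hx + hx' + 2 * h)
    rcases hg.mem_or_mem_of_mem_sup hd (add_mem hxT hxU) with h1 | h1
    · simpa using sub_mem h1 (Algebra.self_mem_adjoin_singleton K x)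
    · have h2 : x ∈ Algebra.adjoin K {x'} := by
        simpa using sub_mem h1 (Algebra.self_mem_adjoin_singleton K x')
      exact IsSqZeroOrIdem.mem_adjoin_of_mem (Or.inl hx') h2
        fun hb => hx0 (eq_zero_of_sq_eq_zero_of_mem_bot hx hb)
  · exfalso
    have hg : IsSqZeroOrIdem (x * x') := Or.inl (by linear_combination x' ^ 2 * hx)
    rcases hg.mem_or_mem_of_mem_sup hd (mul_mem hxT hxU) with h1 | h1
    · obtain ⟨b, hb⟩ := mul_eq_algebraMap_mul_of_mem_adjoin hx h1
      have : algebraMap K A b * (x * x') = 0 := by linear_combination (-x') * hb + x * hx'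
      rcases eq_zero_or_eq_zero_of_algebraMap_mul this with rfl | h2
      · exact h (by simpa using hb)
      · exact h h2
    · rw [mul_comm] at h1
      obtain ⟨b, hb⟩ := mul_eq_algebraMap_mul_of_mem_adjoin hx' h1
      have : algebraMap K A b * (x * x') = 0 := by linear_combination (-x) * hb + x' * hx
      rcases eq_zero_or_eq_zero_of_algebraMap_mul this with rfl | h2
      · exact h (by simpa [mul_comm] using hb)
      · exact h h2

theorem mul_eq_zero_or_eq_of_mul_mem_adjoin {e f : A} (he : e ^ 2 = e) (hf : f ^ 2 = f)
    (h : e * f ∈ Algebra.adjoin K {e}) : e * f = 0 ∨ e * f = e := by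
  obtain ⟨a, b, hab⟩ := (IsSqZeroOrIdem.mem_adjoin_iff (Or.inr he)).1 h
  have h1 : e * f = algebraMap K A (a + b) * e := by
    rw [map_add]
    linear_combination e * hab + (algebraMap K A b - f) * he
  have h2 : algebraMap K A ((a + b) * (a + b - 1)) * e = 0 := by
    rw [map_mul, map_sub, map_one]
    set c := algebraMap K A (a + b)
    linear_combination (1 - c - e * f) * h1 + f ^ 2 * he + e * hf - c * f * he
  rcases eq_zero_or_eq_zero_of_algebraMap_mul h2 with h3 | h3
  · rcases mul_eq_zero.1 h3 with h4 | h4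
    · left; simpa [h4] using h1
    · right; simpa [sub_eq_zero.1 h4] using h1
  · left; simp [h3]

theorem mem_adjoin_of_sq_eq_self (hd : IsDistributiveExtension K A) {e f : A} (he : e ^ 2 = e)
    (he0 : e ∉ (⊥ : Subalgebra K A)) (hf : f ^ 2 = f) : f ∈ Algebra.adjoin K {e} := by
  by_contra hc
  have hc' : e ∉ Algebra.adjoin K {f} := fun h =>
    hc (IsSqZeroOrIdem.mem_adjoin_of_mem (Or.inr hf) h he0)
  have heT : e ∈ Algebra.adjoin K {e} ⊔ Algebra.adjoin K {f} :=
    le_sup_left (a := Algebra.adjoin K {e}) (Algebra.self_mem_adjoin_singleton K e)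
  have hfT : f ∈ Algebra.adjoin K {e} ⊔ Algebra.adjoin K {f} :=
    le_sup_right (b := Algebra.adjoin K {f}) (Algebra.self_mem_adjoin_singleton K f)
  -- The symmetric difference of `e` and `f`: once `e * f` is known to be `0`, `e` or `f`, its
  -- membership in `K[e]` or `K[f]` gives back the missing idempotent.
  have hs : IsSqZeroOrIdem (e + f - 2 * (e * f)) := Or.inr (by
    linear_combination (1 - 4 * f + 4 * f ^ 2) * he + (1 - 4 * e + 4 * e) * hf)
  have hs' := hs.mem_or_mem_of_mem_sup hd (T := Algebra.adjoin K {e}) (U := Algebra.adjoin K {f})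
    (by rw [two_mul]; exact sub_mem (add_mem heT hfT) (add_mem (mul_mem heT hfT) (mul_mem heT hfT)))
  have hp : IsSqZeroOrIdem (e * f) := Or.inr (by linear_combination f ^ 2 * he + e * hf)
  have hef : e * f = 0 ∨ e * f = e ∨ e * f = f := by
    rcases hp.mem_or_mem_of_mem_sup hd (mul_mem heT hfT) with h | h
    · rcases mul_eq_zero_or_eq_of_mul_mem_adjoin he hf h with h | h <;> simp [h]
    · rw [mul_comm] at h ⊢
      rcases mul_eq_zero_or_eq_of_mul_mem_adjoin hf he h with h | h <;> simp [h]
  have hE := Algebra.self_mem_adjoin_singleton K e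
  have hF := Algebra.self_mem_adjoin_singleton K f
  rcases hs' with h | h
  · apply hc
    rcases hef with h0 | h0 | h0 <;> rw [h0] at h
    · convert sub_mem h hE using 1; ring
    · convert add_mem h hE using 1; ring
    · convert sub_mem hE h using 1; ring
  · apply hc'
    rcases hef with h0 | h0 | h0 <;> rw [h0] at h
    · convert sub_mem h hF using 1; ring
    · convert sub_mem hF h using 1; ring
    · convert add_mem h hF using 1; ring

/-- As `t - r` is not a unit, `r` is a root of the minimal polynomial, which factors as `(X - r) *
q`. Then `(t - r) * q(t) = 0`, so `q(t) ^ 2 = q(r) * q(t)`: either `q(t)` is square-zero or `q(t) /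
q(r)` is idempotent. -/
theorem exists_isSqZeroOrIdem_mem_adjoin {t : A} (ht : IsIntegral K t)
    (htb : t ∉ (⊥ : Subalgebra K A)) {r : K} (hr : ¬ IsUnit (t - algebraMap K A r)) :
    ∃ z ∈ Algebra.adjoin K {t}, z ∉ (⊥ : Subalgebra K A) ∧ IsSqZeroOrIdem z := by
  have hA : Nontrivial A := by
    by_contra h
    rw [not_nontrivial_iff_subsingleton] at h
    exact htb (Subsingleton.elim (0 : A) t ▸ zero_mem _)
  have hdiv : ∀ p : Polynomial K, Polynomial.aeval t p =
      (t - algebraMap K A r) * Polynomial.aeval t (p /ₘ (Polynomial.X - Polynomial.C r)) +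
        algebraMap K A (p.eval r) := by
    intro p
    conv_lhs => rw [← Polynomial.modByMonic_add_div p (Polynomial.X - Polynomial.C r),
      Polynomial.modByMonic_X_sub_C_eq_C_eval]
    simp [add_comm]
  set p := minpoly K t with hp
  set q := p /ₘ (Polynomial.X - Polynomial.C r) with hq
  have hroot : p.eval r = 0 := by
    by_contra h0
    have h1 := hdiv p
    rw [hp, minpoly.aeval, ← hp] at h1
    apply hr
    have hu : IsUnit (algebraMap K A (-(p.eval r))) :=
      (IsUnit.mk0 _ (neg_ne_zero.2 h0)).map (algebraMap K A)
    refine isUnit_of_mul_isUnit_left (y := Polynomial.aeval t q) ?_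
    convert hu using 1
    rw [map_neg]
    linear_combination -h1
  have hpq : (Polynomial.X - Polynomial.C r) * q = p :=
    Polynomial.mul_divByMonic_eq_iff_isRoot.2 hroot
  have hpm : p.Monic := minpoly.monic ht
  have hnd : ∀ u : Polynomial K, u ≠ 0 → u.natDegree < p.natDegree → Polynomial.aeval t u ≠ 0 := by
    intro u hu0 hu h
    exact absurd (Polynomial.natDegree_le_natDegree (minpoly.degree_le_of_ne_zero K t hu0 h)) (by simpa using hu)
  have hq0 : q ≠ 0 := by
    rintro h
    rw [h, mul_zero] at hpq
    exact hpm.ne_zero hpq.symm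
  have hqdeg : p.natDegree = 1 + q.natDegree := by
    rw [← hpq, Polynomial.natDegree_mul (Polynomial.X_sub_C_ne_zero r) hq0,
      Polynomial.natDegree_X_sub_C]
  have hmem : ∀ u : Polynomial K, Polynomial.aeval t u ∈ Algebra.adjoin K {t} := fun u =>
    Polynomial.aeval_mem_adjoin_singleton K t
  have htq : (t - algebraMap K A r) * Polynomial.aeval t q = 0 := by
    have := congrArg (Polynomial.aeval t) hpq
    simpa [hp] using this
  by_cases h0 : q.eval r = 0
  · have hx2 : (Polynomial.aeval t q) ^ 2 = 0 := by
      have h1 := hdiv q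
      rw [h0, map_zero, add_zero] at h1
      rw [sq]
      nth_rewrite 1 [h1]
      rw [mul_right_comm, htq, zero_mul]
    refine ⟨Polynomial.aeval t q, hmem q, fun h => ?_, Or.inl hx2⟩
    exact hnd q hq0 (by omega) (eq_zero_of_sq_eq_zero_of_mem_bot hx2 h)
  · set e := algebraMap K A (q.eval r)⁻¹ * Polynomial.aeval t q with he
    have hc : algebraMap K A (q.eval r)⁻¹ * algebraMap K A (q.eval r) = 1 := by
      rw [← map_mul, inv_mul_cancel₀ h0, map_one]
    have hte : (t - algebraMap K A r) * e = 0 := by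
      rw [he]; linear_combination algebraMap K A (q.eval r)⁻¹ * htq
    have he2 : e ^ 2 = e := by
      have h1 := hdiv q
      have h2 : e * Polynomial.aeval t q = algebraMap K A (q.eval r) * e := by
        rw [h1]
        linear_combination
          Polynomial.aeval t (q /ₘ (Polynomial.X - Polynomial.C r)) * hte
      have h3 : e ^ 2 = algebraMap K A (q.eval r)⁻¹ * (e * Polynomial.aeval t q) := by
        rw [he]; ring
      rw [h3, h2, ← mul_assoc, hc, one_mul]
    refine ⟨e, mul_mem (Subalgebra.algebraMap_mem _ _) (hmem q), fun h => ?_, Or.inr he2⟩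
    obtain ⟨a, ha⟩ := Algebra.mem_bot.1 h
    have ha0 : a ≠ 0 := by
      rintro rfl
      refine hnd q hq0 (by omega) ?_
      rw [map_zero, he] at ha
      linear_combination (-algebraMap K A (q.eval r)) * ha - (Polynomial.aeval t q) * hc
    rw [← ha, mul_comm] at hte
    rcases eq_zero_or_eq_zero_of_algebraMap_mul hte with h | h
    · exact ha0 h
    · exact htb (sub_eq_zero.1 h ▸ Subalgebra.algebraMap_mem _ r)

theorem exists_sqZero_idem_adjoin_eq_top (hB : IsBooleanExtension K A)
    (hint : Algebra.IsIntegral K A) (hres : ∀ t : A, ∃ r : K, ¬ IsUnit (t - algebraMap K A r)) :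
    ∃ x y : A, Algebra.adjoin K {x, y} = ⊤ ∧ x ^ 2 = 0 ∧ x * y = 0 ∧ y ^ 2 = y := by
  have hd := hB.distributive
  obtain ⟨x, hx2, hx⟩ : ∃ x : A, x ^ 2 = 0 ∧ ∀ x' : A, x' ^ 2 = 0 → x' ∈ Algebra.adjoin K {x} := by
    by_cases h : ∃ x : A, x ^ 2 = 0 ∧ x ≠ 0
    · obtain ⟨x, hx, hx0⟩ := h
      exact ⟨x, hx, fun x' hx' => mem_adjoin_of_sq_eq_zero hd hx hx0 hx'⟩
    · push Not at h
      exact ⟨0, by simp, fun x' hx' => by rw [h x' hx']; exact zero_mem _⟩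
  obtain ⟨y, hy2, hy⟩ : ∃ y : A, y ^ 2 = y ∧ ∀ y' : A, y' ^ 2 = y' → y' ∈ Algebra.adjoin K {y} := by
    by_cases h : ∃ y : A, y ^ 2 = y ∧ y ∉ (⊥ : Subalgebra K A)
    · obtain ⟨y, hy, hy0⟩ := h
      exact ⟨y, hy, fun y' hy' => mem_adjoin_of_sq_eq_self hd hy hy0 hy'⟩
    · push Not at h
      exact ⟨0, by simp, fun y' hy' => bot_le (a := Algebra.adjoin K {0}) (h y' hy')⟩
  -- Here `x * y = b * x` with `b * (b - 1) * x = 0`; when `b = 1`, replacing `y` by `1 - y` makes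
  -- the product vanish.
  obtain ⟨y, hy2, hxy, hy⟩ : ∃ y : A, y ^ 2 = y ∧ x * y = 0 ∧
      ∀ y' : A, y' ^ 2 = y' → y' ∈ Algebra.adjoin K {y} := by
    obtain ⟨b, hb⟩ := mul_eq_algebraMap_mul_of_mem_adjoin hx2
      (hx (x * y) (by linear_combination y ^ 2 * hx2))
    have h1 : algebraMap K A (b * (b - 1)) * x = 0 := by
      rw [map_mul, map_sub, map_one]
      linear_combination (1 - algebraMap K A b - y) * hb + x * hy2
    rcases eq_zero_or_eq_zero_of_algebraMap_mul h1 with h2 | h2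
    · rcases mul_eq_zero.1 h2 with h3 | h3
      · exact ⟨y, hy2, by simpa [h3] using hb, hy⟩
      · rw [sub_eq_zero.1 h3, map_one, one_mul] at hb
        refine ⟨1 - y, by linear_combination hy2, by linear_combination -hb, fun y' hy' => ?_⟩
        refine Algebra.adjoin_le (Set.singleton_subset_iff.2 ?_) (hy y' hy')
        have := sub_mem (one_mem _) (Algebra.self_mem_adjoin_singleton K (1 - y))
        rwa [sub_sub_cancel] at this
    · exact ⟨y, hy2, by simp [h2], hy⟩
  refine ⟨x, y, ?_, hx2, hxy, hy2⟩
  obtain ⟨T, hT, hT'⟩ := hB.exists_compl (Algebra.adjoin K {x, y})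
  suffices T = ⊥ by rwa [this, sup_bot_eq] at hT'
  rw [eq_bot_iff]
  intro t ht
  by_contra htb
  obtain ⟨r, hr⟩ := hres t
  obtain ⟨z, hz, hzb, hzs⟩ := exists_isSqZeroOrIdem_mem_adjoin (hint.isIntegral t) htb hr
  refine hzb (hT ▸ ⟨?_, Algebra.adjoin_le (Set.singleton_subset_iff.2 ht) hz⟩)
  rcases hzs with h | h
  · exact Algebra.adjoin_mono (by simp) (hx z h)
  · exact Algebra.adjoin_mono (by simp) (hy z h)

theorem isBooleanExtension_of_sqZero_idem {x y : A} (hxy : Algebra.adjoin K {x, y} = ⊤)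
    (hx : x ^ 2 = 0) (h0 : x * y = 0) (hy : y ^ 2 = y) : IsBooleanExtension K A := by
  have hform : ∀ t : A, ∃ a b c : K,
      t = algebraMap K A a + algebraMap K A b * x + algebraMap K A c * y := by
    intro t
    have ht : t ∈ Algebra.adjoin K {x, y} := hxy ▸ Algebra.mem_top
    induction ht using Algebra.adjoin_induction with
    | mem u hu =>
      rcases hu with rfl | rfl
      · exact ⟨0, 1, 0, by simp⟩
      · exact ⟨0, 0, 1, by simp⟩
    | algebraMap r => exact ⟨r, 0, 0, by simp⟩
    | add u v _ _ hu hv =>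
      obtain ⟨a, b, c, rfl⟩ := hu
      obtain ⟨a', b', c', rfl⟩ := hv
      exact ⟨a + a', b + b', c + c', by simp only [map_add]; ring⟩
    | mul u v _ _ hu hv =>
      obtain ⟨a, b, c, rfl⟩ := hu
      obtain ⟨a', b', c', rfl⟩ := hv
      refine ⟨a * a', a * b' + b * a', a * c' + c * a' + c * c', ?_⟩
      simp only [map_add, map_mul]
      linear_combination (algebraMap K A b * algebraMap K A b') * hx +
        (algebraMap K A c * algebraMap K A c') * hy +
        (algebraMap K A b * algebraMap K A c' + algebraMap K A b' * algebraMap K A c) * h0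
  have hsplit : ∀ (T : Subalgebra K A) (a b c : K),
      algebraMap K A a + algebraMap K A b * x + algebraMap K A c * y ∈ T →
        (b = 0 ∨ x ∈ T) ∧ (c = 0 ∨ y ∈ T) := by
    intro T a b c h
    have h1 : algebraMap K A b * x + algebraMap K A c * y ∈ T := by
      convert sub_mem h (T.algebraMap_mem a) using 1; ring
    have hyT : c = 0 ∨ y ∈ T := by
      by_cases hc : c = 0
      · exact Or.inl hc
      · right
        -- Squaring `b * x + c * y` leaves only `c ^ 2 * y`.
        refine Subalgebra.mem_of_algebraMap_mul_mem (b := c ^ 2) (pow_ne_zero 2 hc) ?_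
        convert pow_mem h1 2 using 1
        rw [map_pow]
        linear_combination -(algebraMap K A b) ^ 2 * hx - (algebraMap K A c) ^ 2 * hy -
          2 * algebraMap K A b * algebraMap K A c * h0
    refine ⟨?_, hyT⟩
    have h2 : algebraMap K A b * x ∈ T := by
      rcases hyT with rfl | h3
      · simpa using h1
      · simpa using sub_mem h1 (mul_mem (T.algebraMap_mem c) h3)
    by_cases hb : b = 0
    · exact Or.inl hb
    · exact Or.inr (Subalgebra.mem_of_algebraMap_mul_mem hb h2)
  have hle : ∀ T U : Subalgebra K A, (x ∈ T → x ∈ U) → (y ∈ T → y ∈ U) → T ≤ U := by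
    intro T U h1 h2 t ht
    obtain ⟨a, b, c, rfl⟩ := hform t
    obtain ⟨h3, h4⟩ := hsplit T a b c ht
    refine add_mem (add_mem (U.algebraMap_mem a) ?_) ?_
    · rcases h3 with rfl | h3
      · simp
      · exact mul_mem (U.algebraMap_mem b) (h1 h3)
    · rcases h4 with rfl | h4
      · simp
      · exact mul_mem (U.algebraMap_mem c) (h2 h4)
  have hxy' : x ∈ Algebra.adjoin K {y} → x = 0 := by
    intro h
    obtain ⟨a, b, hab⟩ := (IsSqZeroOrIdem.mem_adjoin_iff (Or.inr hy)).1 h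
    have h1 : algebraMap K A a * x = 0 := by
      linear_combination (-x) * hab + hx - (algebraMap K A b) * h0
    rcases eq_zero_or_eq_zero_of_algebraMap_mul h1 with rfl | h1
    · have h2 : algebraMap K A b * y = 0 := by
        rw [map_zero] at hab
        linear_combination (-y) * hab + h0 - algebraMap K A b * hy
      simpa [h2] using hab
    · exact h1
  have hyx' : y ∈ Algebra.adjoin K {x} → y ∈ (⊥ : Subalgebra K A) := by
    intro h
    obtain ⟨a, b, hab⟩ := (IsSqZeroOrIdem.mem_adjoin_iff (Or.inl hx)).1 h
    have h1 : algebraMap K A a * x = 0 := by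
      linear_combination (-x) * hab + h0 - (algebraMap K A b) * hx
    rcases eq_zero_or_eq_zero_of_algebraMap_mul h1 with rfl | rfl
    · have : y = 0 := by
        rw [map_zero] at hab
        linear_combination (y + algebraMap K A b * x) * hab + (algebraMap K A b) ^ 2 * hx - hy
      exact this ▸ zero_mem _
    · rw [hab]; simp
  -- If `T` and `U` both miss `x`, both lie in `K[y]`, which contains `x` only if `x = 0`.
  have hxsup : ∀ T U : Subalgebra K A, x ∈ T ⊔ U ↔ x ∈ T ∨ x ∈ U := by
    refine fun T U => ⟨fun h => ?_, fun h => h.elim (fun h => le_sup_left (a := T) h)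
      (fun h => le_sup_right (b := U) h)⟩
    by_contra! hc
    have hY := Algebra.self_mem_adjoin_singleton K y
    have := hxy' (sup_le (hle T (Algebra.adjoin K {y}) (fun h => absurd h hc.1) fun _ => hY)
      (hle U _ (fun h => absurd h hc.2) fun _ => hY) h)
    exact hc.1 (this ▸ zero_mem _)
  have hysup : ∀ T U : Subalgebra K A, y ∈ T ⊔ U ↔ y ∈ T ∨ y ∈ U := by
    refine fun T U => ⟨fun h => ?_, fun h => h.elim (fun h => le_sup_left (a := T) h)
      (fun h => le_sup_right (b := U) h)⟩
    by_contra! hc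
    have hX := Algebra.self_mem_adjoin_singleton K x
    have := hyx' (sup_le (hle T (Algebra.adjoin K {x}) (fun _ => hX) fun h => absurd h hc.1)
      (hle U _ (fun _ => hX) fun h => absurd h hc.2) h)
    exact hc.1 (bot_le (a := T) this)
  have hext : ∀ T U : Subalgebra K A, (x ∈ T ↔ x ∈ U) → (y ∈ T ↔ y ∈ U) → T = U :=
    fun T U h1 h2 => le_antisymm (hle T U h1.1 h2.1) (hle U T h1.2 h2.2)
  refine ⟨⟨fun T U V => hext _ _ ?_ ?_, fun T U V => hext _ _ ?_ ?_⟩, fun T => ?_⟩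
  · simp only [hxsup, Algebra.mem_inf]; tauto
  · simp only [hysup, Algebra.mem_inf]; tauto
  · simp only [hxsup, Algebra.mem_inf]; tauto
  · simp only [hysup, Algebra.mem_inf]; tauto
  -- The complement is generated by those of `x`, `y` that `T` misses.
  · refine ⟨Algebra.adjoin K {z | (z = x ∨ z = y) ∧ z ∉ T}, ?_, ?_⟩
    · refine eq_bot_iff.2 (hle _ _ ?_ ?_)
      · rintro ⟨h1, h2⟩
        refine hxy' (Algebra.adjoin_mono ?_ h2) ▸ zero_mem _
        rintro z ⟨rfl | rfl, h3⟩
        · exact absurd h1 h3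
        · rfl
      · rintro ⟨h1, h2⟩
        refine hyx' (Algebra.adjoin_mono ?_ h2)
        rintro z ⟨rfl | rfl, h3⟩
        · rfl
        · exact absurd h1 h3
    · refine eq_top_iff.2 (hle _ _ (fun _ => (hxsup _ _).2 ?_) (fun _ => (hysup _ _).2 ?_))
      · by_cases h : x ∈ T
        · exact Or.inl h
        · exact Or.inr (Algebra.subset_adjoin ⟨Or.inl rfl, h⟩)
      · by_cases h : y ∈ T
        · exact Or.inl h
        · exact Or.inr (Algebra.subset_adjoin ⟨Or.inr rfl, h⟩)

end Field

/-! ### Residue fields, and the maximal ideal as a conductor -/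

theorem IsInfraIntegralExtension.exists_sub_algebraMap_mem {R S : Type*} [CommRing R]
    [CommRing S] [Algebra R S] (h : IsInfraIntegralExtension R S)
    (Q : Ideal S) [Q.IsMaximal] (t : S) : ∃ r : R, t - algebraMap R S r ∈ Q := by
  have := h.isIntegral
  have hmax : (Q.comap (algebraMap R S)).IsMaximal :=
    Ideal.isMaximal_comap_of_isIntegral_of_isMaximal Q
  -- Because `Q ∩ R` is maximal, `R` itself surjects onto its residue field, hence onto that of `Q`.
  obtain ⟨c, hc⟩ := (h.bijective_residue Q).surjective (algebraMap S Q.ResidueField t)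
  obtain ⟨r, rfl⟩ := Ideal.algebraMap_residueField_surjective (Q.comap (algebraMap R S)) c
  refine ⟨r, ?_⟩
  rw [← Ideal.algebraMap_residueField_eq_zero, map_sub, ← hc, sub_eq_zero]
  simp

theorem Submodule.mul_mem_smul_toSubmodule {R S : Type*} [CommRing R] [CommRing S]
    [Algebra R S] {I : Ideal R} {T : Subalgebra R S} {u v : S}
    (hu : u ∈ I • Subalgebra.toSubmodule T) (hv : v ∈ T) : u * v ∈ I • Subalgebra.toSubmodule T := by
  induction hu using Submodule.smul_induction_on' with
  | smul r hr n hn =>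
    rw [smul_mul_assoc]
    exact Submodule.smul_mem_smul hr (T.mul_mem hn hv)
  | add a _ b _ ha hb =>
    rw [add_mul]
    exact add_mem ha hb

section Conductor

variable {R S : Type*} [CommRing R] [IsLocalRing R] [CommRing S] [Algebra R S]

open IsLocalRing

/-- The maximal ideal of a local ring is the conductor of every minimal integral extension. -/
theorem IsAtom.mul_mem_maximalIdealIn [Algebra.IsIntegral R S] {T : Subalgebra R S}
    (hT : IsAtom T) {t m : S} (ht : t ∈ T) (hm : m ∈ maximalIdealIn R S) :
    t * m ∈ maximalIdealIn R S := by
  -- An atom is generated by one integral element, which gives the finiteness Nakayama needs.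
  have hfg : (Subalgebra.toSubmodule T).FG := by
    obtain ⟨a, haT, ha⟩ := SetLike.exists_of_lt hT.bot_lt
    have hle : Algebra.adjoin R {a} ≤ T := Algebra.adjoin_le (Set.singleton_subset_iff.2 haT)
    have : Algebra.adjoin R {a} = T := (hT.le_iff.1 hle).resolve_left fun h =>
      ha (h ▸ Algebra.self_mem_adjoin_singleton R a)
    rw [← this]
    exact (Algebra.IsIntegral.isIntegral a).fg_adjoin_singleton
  have hjac : maximalIdeal R ≤ Ideal.jacobson ⊥ :=
    (IsLocalRing.jacobson_eq_maximalIdeal ⊥ bot_ne_top).ge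
  set N := maximalIdeal R • Subalgebra.toSubmodule T with hN
  have hNT : N ≤ Subalgebra.toSubmodule T := Submodule.smul_le_right
  have hNbot : N ≤ Subalgebra.toSubmodule (⊥ : Subalgebra R S) := by
    -- `R + M T` is a subalgebra between `R` and `T`, so it equals one of them; Nakayama excludes
    -- `T`.
    let B : Subalgebra R S :=
      { Subalgebra.toSubmodule (⊥ : Subalgebra R S) ⊔ N with
        mul_mem' := by
          intro a b ha hb
          obtain ⟨c, hc, u, hu, rfl⟩ := Submodule.mem_sup.1 ha
          obtain ⟨d, hd, v, hv, rfl⟩ := Submodule.mem_sup.1 hb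
          refine Submodule.mem_sup.2 ⟨c * d, mul_mem (S := Subalgebra R S) (s := ⊥) hc hd,
            u * (d + v) + v * c, add_mem ?_ ?_, by ring⟩
          · exact Submodule.mul_mem_smul_toSubmodule hu (add_mem (bot_le (a := T) hd) (hNT hv))
          · exact Submodule.mul_mem_smul_toSubmodule hv (bot_le (a := T) hc)
        algebraMap_mem' := fun r =>
          (le_sup_left : _ ≤ Subalgebra.toSubmodule (⊥ : Subalgebra R S) ⊔ N)
            ((⊥ : Subalgebra R S).algebraMap_mem r) }
    have hBT : B ≤ T := by
      intro b hb
      obtain ⟨c, hc, u, hu, rfl⟩ := Submodule.mem_sup.1 hb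
      exact add_mem (bot_le (a := T) hc) (hNT hu)
    rcases hT.le_iff.1 hBT with h | h
    · intro u hu
      have : u ∈ B := (le_sup_right : N ≤ Subalgebra.toSubmodule (⊥ : Subalgebra R S) ⊔ N) hu
      exact h ▸ this
    · exfalso
      refine hT.1 (eq_bot_iff.2 ?_)
      have : Subalgebra.toSubmodule T ≤ Subalgebra.toSubmodule (⊥ : Subalgebra R S) ⊔ N :=
        fun t ht => show t ∈ B from h ▸ ht
      exact Submodule.le_of_le_smul_of_le_jacobson_bot hfg hjac this
  obtain ⟨m, hm, rfl⟩ := hm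
  have hmt : t * algebraMap R S m ∈ N := by
    rw [mul_comm, ← Algebra.smul_def]
    exact Submodule.smul_mem_smul hm ht
  obtain ⟨r, hr⟩ := Algebra.mem_bot.1 (hNbot hmt)
  refine ⟨r, ?_, hr⟩
  by_contra hrM
  have hru : IsUnit r := by simpa using hrM
  obtain ⟨r', hr'⟩ := hru.exists_left_inv
  -- If `t * m` came from a unit of `R`, then `M T = T`, and Nakayama would give `T = 0`.
  have h1 : (1 : S) ∈ N := by
    have := N.smul_mem r' hmt
    rwa [← hr, Algebra.smul_def, ← map_mul, hr', map_one] at this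
  have h2 : Subalgebra.toSubmodule T ≤ ⊥ ⊔ N := by
    intro v hv
    rw [bot_sup_eq]
    simpa using Submodule.mul_mem_smul_toSubmodule h1 hv
  have h3 := Submodule.le_of_le_smul_of_le_jacobson_bot hfg hjac h2
  have h4 : (1 : S) = 0 := by simpa using h3 (one_mem T)
  have : Subsingleton S := subsingleton_of_zero_eq_one h4.symm
  exact hT.1 (Subsingleton.elim _ _)

/-- The elements `s` with `s M ⊆ M` form a subalgebra containing every atom. Its complement thus
contains no atom and, `[R, S]` being finite, must be `R`. -/
theorem mul_mem_maximalIdealIn_of_isBooleanExtension [Algebra.IsIntegral R S]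
    (hfip : IsFIPExtension R S) (hB : IsBooleanExtension R S) (s : S) {m : S}
    (hm : m ∈ maximalIdealIn R S) : s * m ∈ maximalIdealIn R S := by
  let N : Subalgebra R S :=
    { carrier := {s | ∀ m ∈ maximalIdealIn R S, s * m ∈ maximalIdealIn R S}
      mul_mem' := fun {a b} ha hb m hm => by
        rw [mul_assoc]
        exact ha _ (hb m hm)
      add_mem' := fun {a b} ha hb m hm => by
        obtain ⟨u, hu, hu'⟩ := ha m hm
        obtain ⟨v, hv, hv'⟩ := hb m hm
        exact ⟨u + v, add_mem hu hv, by rw [map_add, hu', hv', add_mul]⟩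
      algebraMap_mem' := by
        rintro r _ ⟨m, hm, rfl⟩
        exact ⟨r * m, Ideal.mul_mem_left _ r hm, map_mul _ _ _⟩ }
  have : Finite (Subalgebra R S) := hfip
  obtain ⟨T, hT, hT'⟩ := hB.exists_compl N
  rcases eq_bot_or_exists_atom_le T with h | ⟨U, hU, hUT⟩
  · rw [h, sup_bot_eq] at hT'
    exact (hT' ▸ Algebra.mem_top : s ∈ N) m hm
  · exfalso
    refine hU.1 (eq_bot_iff.2 (hT ▸ le_inf ?_ hUT))
    exact fun t ht m hm => hU.mul_mem_maximalIdealIn ht hm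

theorem maximalIdealIn_eq_map (h : ∀ s : S, ∀ m ∈ maximalIdealIn R S, s * m ∈ maximalIdealIn R S) :
    maximalIdealIn R S = (maximalIdeal R).map (algebraMap R S) := by
  refine Set.Subset.antisymm ?_ fun s hs => ?_
  · rintro _ ⟨m, hm, rfl⟩
    exact Ideal.mem_map_of_mem _ hm
  · induction hs using Submodule.span_induction with
    | mem x hx => exact hx
    | zero => exact ⟨0, zero_mem _, map_zero _⟩
    | add x y _ _ hx hy =>
      obtain ⟨u, hu, rfl⟩ := hx
      obtain ⟨v, hv, rfl⟩ := hy
      exact ⟨u + v, add_mem hu hv, map_add _ _ _⟩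
    | smul a x _ hx => exact h a x hx

theorem IsSpecialPair.mul_mem_maximalIdealIn {x y : S} (h : IsSpecialPair R x y) (s m : S)
    (hm : m ∈ maximalIdealIn R S) : s * m ∈ maximalIdealIn R S := by
  have hs : s ∈ Algebra.adjoin R {x, y} := h.adjoin_eq_top ▸ Algebra.mem_top
  induction hs using Algebra.adjoin_induction generalizing m with
  | mem u hu =>
    rcases hu with rfl | rfl
    · exact h.left_mul_mem m hm
    · exact h.right_mul_mem m hm
  | algebraMap r =>
    obtain ⟨m, hm, rfl⟩ := hm
    exact ⟨r * m, Ideal.mul_mem_left _ r hm, map_mul _ _ _⟩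
  | add u v _ _ hu hv =>
    obtain ⟨a, ha, ha'⟩ := hu m hm
    obtain ⟨b, hb, hb'⟩ := hv m hm
    exact ⟨a + b, add_mem ha hb, by rw [map_add, ha', hb', add_mul]⟩
  | mul u v _ _ hu hv =>
    rw [mul_assoc]
    exact hu _ (hv m hm)

theorem maximalIdealIn_subset (T : Subalgebra R S) : maximalIdealIn R S ⊆ T := by
  rintro _ ⟨m, -, rfl⟩
  exact T.algebraMap_mem m

/-- Modulo `M`, which lies in every subalgebra, `(x + y) ^ 2` is `y`. -/
theorem IsSpecialPair.adjoin_add_eq_top {x y : S} (h : IsSpecialPair R x y) :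
    Algebra.adjoin R {x + y} = ⊤ := by
  set T := Algebra.adjoin R {x + y}
  have hT : ∀ {m}, m ∈ maximalIdealIn R S → m ∈ T := fun hm => maximalIdealIn_subset T hm
  have hxy : x + y ∈ T := Algebra.self_mem_adjoin_singleton R (x + y)
  have hy : y ∈ T := by
    have := sub_mem (sub_mem (sub_mem (pow_mem hxy 2) (hT h.sq_mem)) (hT h.sq_sub_mem))
      (add_mem (hT h.mul_mem) (hT h.mul_mem))
    convert this using 1
    ring
  have hx : x ∈ T := by simpa using sub_mem hxy hy
  rw [eq_top_iff, ← h.adjoin_eq_top]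
  refine Algebra.adjoin_le ?_
  rintro z (rfl | rfl) <;> assumption

end Conductor

/-! ### Transport along isomorphisms of subalgebra lattices -/

theorem isBooleanExtension_congr {R S K A : Type*} [CommRing R] [CommRing S] [CommRing K]
    [CommRing A] [Algebra R S] [Algebra K A] (e : Subalgebra K A ≃o Subalgebra R S)
    (h : IsBooleanExtension K A) : IsBooleanExtension R S := by
  refine ⟨⟨fun T U V => e.symm.injective ?_, fun T U V => e.symm.injective ?_⟩, fun T => ?_⟩
  · simp only [map_sup, map_inf, h.distributive.inf_sup]
  · simp only [map_sup, map_inf, h.distributive.sup_inf]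
  · obtain ⟨T', h1, h2⟩ := h.exists_compl (e.symm T)
    refine ⟨e T', e.symm.injective ?_, e.symm.injective ?_⟩
    · simpa using h1
    · simpa using h2

section BaseChange

variable {R S K A : Type*} [CommRing R] [CommRing S] [CommRing K] [CommRing A]
  [Algebra R S] [Algebra R K] [Algebra R A] [Algebra K A] [IsScalarTower R K A]

/-- Subalgebras of `S` correspond to those of a quotient by an ideal lying in the base ring. -/
def subalgebraOrderIsoOfKer (π : S →ₐ[R] A) (hπ : Function.Surjective π)
    (hK : Function.Surjective (algebraMap R K))
    (hker : ∀ s, π s = 0 → s ∈ (⊥ : Subalgebra R S)) : Subalgebra K A ≃o Subalgebra R S where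
  toFun T := (T.restrictScalars R).comap π
  invFun U :=
    { (U.map π).toSubsemiring with
      algebraMap_mem' := fun k => by
        obtain ⟨r, rfl⟩ := hK k
        rw [← IsScalarTower.algebraMap_apply]
        exact (U.map π).algebraMap_mem r }
  left_inv T := by
    ext a
    constructor
    · rintro ⟨s, hs, rfl⟩
      exact hs
    · intro ha
      obtain ⟨s, rfl⟩ := hπ a
      exact ⟨s, ha, rfl⟩
  right_inv U := by
    ext s
    constructor
    · rintro ⟨u, hu, hus⟩
      have : s - u ∈ U := bot_le (a := U) (hker _ (by rw [map_sub, sub_eq_zero]; exact hus.symm))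
      simpa using add_mem this hu
    · intro hs
      exact ⟨s, hs, rfl⟩
  map_rel_iff' {T U} := by
    constructor
    · intro h a ha
      obtain ⟨s, rfl⟩ := hπ a
      exact h (show s ∈ (T.restrictScalars R).comap π from ha)
    · intro h s hs
      exact h hs

end BaseChange

/-! ### Passage to the quotient by `M` and the main theorem -/

section Main

variable {R S : Type*} [CommRing R] [IsLocalRing R] [CommRing S] [Algebra R S]

open IsLocalRing

/-- Subalgebras of `S` modulo the maximal ideal of `R`, when the latter is an ideal of `S`. -/
noncomputable def subalgebraQuotientOrderIso
    (h : ∀ s : S, ∀ m ∈ maximalIdealIn R S, s * m ∈ maximalIdealIn R S) :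
    Subalgebra (R ⧸ maximalIdeal R) (S ⧸ (maximalIdeal R).map (algebraMap R S)) ≃o
      Subalgebra R S :=
  subalgebraOrderIsoOfKer (Ideal.Quotient.mkₐ R ((maximalIdeal R).map (algebraMap R S)))
    Ideal.Quotient.mk_surjective Ideal.Quotient.mk_surjective fun s hs => by
      rw [Ideal.Quotient.mkₐ_eq_mk, Ideal.Quotient.eq_zero_iff_mem, ← SetLike.mem_coe,
        ← maximalIdealIn_eq_map h] at hs
      exact maximalIdealIn_subset _ hs

theorem IsBooleanExtension.exists_isSpecialPair [Nontrivial S] (hfip : IsFIPExtension R S)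
    (hinfra : IsInfraIntegralExtension R S) (hB : IsBooleanExtension R S) :
    ∃ x y : S, IsSpecialPair R x y := by
  have := hinfra.isIntegral
  have hM := fun s m => mul_mem_maximalIdealIn_of_isBooleanExtension hfip hB s (m := m)
  set I := (maximalIdeal R).map (algebraMap R S) with hI
  have hmem : ∀ s, s ∈ maximalIdealIn R S ↔ Ideal.Quotient.mk I s = 0 := fun s => by
    rw [maximalIdealIn_eq_map hM, SetLike.mem_coe, Ideal.Quotient.eq_zero_iff_mem]
  let e := subalgebraQuotientOrderIso hM
  let _ : Field (R ⧸ maximalIdeal R) := Ideal.Quotient.field _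
  have hint : Algebra.IsIntegral (R ⧸ maximalIdeal R) (S ⧸ I) := by
    have : Algebra.IsIntegral R (S ⧸ I) :=
      Algebra.IsIntegral.of_surjective (Ideal.Quotient.mkₐ R I) Ideal.Quotient.mk_surjective
    exact Algebra.IsIntegral.tower_top R
  obtain ⟨Q, hQ⟩ := Ideal.exists_maximal S
  have hIQ : I ≤ Q := by
    have hmax : (Q.comap (algebraMap R S)).IsMaximal :=
      Ideal.isMaximal_comap_of_isIntegral_of_isMaximal Q
    rw [hI, Ideal.map_le_iff_le_comap, IsLocalRing.eq_maximalIdeal hmax]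
  -- Some `t - r` lies in the maximal ideal `Q ⊇ I`, so it stays a non-unit modulo `I`.
  have hres : ∀ t : S ⧸ I, ∃ r : R ⧸ maximalIdeal R,
      ¬ IsUnit (t - algebraMap (R ⧸ maximalIdeal R) (S ⧸ I) r) := by
    intro t
    obtain ⟨t, rfl⟩ := Ideal.Quotient.mk_surjective t
    obtain ⟨r, hr⟩ := hinfra.exists_sub_algebraMap_mem Q t
    refine ⟨Ideal.Quotient.mk (maximalIdeal R) r, fun hu => ?_⟩
    have h1 := hu.map (Ideal.Quotient.factor hIQ)
    have h2 : Ideal.Quotient.mk I t - algebraMap (R ⧸ maximalIdeal R) (S ⧸ I)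
        (Ideal.Quotient.mk (maximalIdeal R) r) = Ideal.Quotient.mk I (t - algebraMap R S r) := by
      rw [map_sub]; rfl
    rw [h2, Ideal.Quotient.factor_mk, Ideal.Quotient.eq_zero_iff_mem.2 hr] at h1
    exact not_isUnit_zero h1
  obtain ⟨x, y, htop, hx, hxy, hy⟩ :=
    exists_sqZero_idem_adjoin_eq_top (isBooleanExtension_congr e.symm hB) hint hres
  obtain ⟨x, rfl⟩ := Ideal.Quotient.mk_surjective x
  obtain ⟨y, rfl⟩ := Ideal.Quotient.mk_surjective y
  refine ⟨x, y, ?_, ?_, ?_, ?_, fun m => hM x m, fun m => hM y m⟩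
  · refine e.symm.injective ?_
    rw [e.symm.map_top, eq_top_iff, ← htop]
    refine Algebra.adjoin_le ?_
    rintro _ (rfl | rfl)
    · exact ⟨x, Algebra.subset_adjoin (by simp), rfl⟩
    · exact ⟨y, Algebra.subset_adjoin (by simp), rfl⟩
  · rw [hmem, map_pow, hx]
  · rw [hmem, map_mul, hxy]
  · rw [hmem, map_sub, map_pow, hy, sub_self]

theorem IsSpecialPair.isBooleanExtension {x y : S} (h : IsSpecialPair R x y) :
    IsBooleanExtension R S := by
  have hM := h.mul_mem_maximalIdealIn
  set I := (maximalIdeal R).map (algebraMap R S) with hI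
  have hmem : ∀ s, s ∈ maximalIdealIn R S ↔ Ideal.Quotient.mk I s = 0 := fun s => by
    rw [maximalIdealIn_eq_map hM, SetLike.mem_coe, Ideal.Quotient.eq_zero_iff_mem]
  let e := subalgebraQuotientOrderIso hM
  let _ : Field (R ⧸ maximalIdeal R) := Ideal.Quotient.field _
  refine isBooleanExtension_congr e (isBooleanExtension_of_sqZero_idem
    (x := Ideal.Quotient.mk I x) (y := Ideal.Quotient.mk I y) ?_ ?_ ?_ ?_)
  · refine e.injective ?_
    rw [e.map_top, eq_top_iff, ← h.adjoin_eq_top]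
    refine Algebra.adjoin_le ?_
    rintro _ (rfl | rfl)
    · exact Algebra.subset_adjoin (Set.mem_insert _ _)
    · exact Algebra.subset_adjoin (Set.mem_insert_of_mem _ rfl)
  · rw [← map_pow, ← hmem]
    exact h.sq_mem
  · rw [← map_mul, ← hmem]
    exact h.mul_mem
  · rw [← sub_eq_zero, ← map_pow, ← map_sub, ← hmem]
    exact h.sq_sub_mem

end Main

theorem proposition4p17 (R S : Type*) [CommRing R] [IsLocalRing R] [CommRing S] [Algebra R S]
    (hinj : Function.Injective (algebraMap R S))
    (hproper : (⊥ : Subalgebra R S) ≠ ⊤)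
    (hfip : IsFIPExtension R S)
    (hinfra : IsInfraIntegralExtension R S) :
    (IsBooleanExtension R S ↔ ∃ x y : S, IsSpecialPair R x y) ∧
      ∀ x y : S, IsSpecialPair R x y → Algebra.adjoin R {x + y} = ⊤ := by
  have : Nontrivial S := hinj.nontrivial
  exact ⟨⟨fun hB => hB.exists_isSpecialPair hfip hinfra,
    fun ⟨_, _, h⟩ => h.isBooleanExtension⟩, fun _ _ h => h.adjoin_add_eq_top⟩
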